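/- Let $k\ge 1$ be an integer, let $\alpha\in\mathbb{R}$ with $|\alpha|\ge 1$, and let $c\in\mathbb{C}$. Write $\partial=\frac12(\partial_x-i\partial_y)$ and $\bar\partial=\frac12(\partial_x+i\partial_y)$, let $\sigma$ be Lebesgue measure on $\mathbb{C}$, and let $L^2(\mathbb{C},e^{-|z|^2})$ be the space of measurable functions $f:\mathbb{C}\to\mathbb{C}$ with $\int_{\mathbb{C}}|f|^2e^{-|z|^2}\,d\sigma<\infty$. For every $f\in L^2(\mathbb{C},e^{-|z|^2})$ there exists $u\in L^2(\mathbb{C},e^{-|z|^2})$ which is a weak solution of $$\alpha\,\partial^k\bar\partial^k u+cu=\alpha f,$$ that is, $\int_{\mathbb{C}}u\,(\alpha\,\partial^k\bar\partial^k\phi+c\,\phi)\,d\sigma=\int_{\mathbb{C}}\alpha f\,\phi\,d\sigma$ for every $C^\infty$ function $\phi:\mathbb{C}\to\mathbb{C}$ with compact support, and which satisfies $$\int_{\mathbb{C}}|u|^2e^{-|z|^2}\,d\sigma\le\frac{|\alpha|^2}{(k!)^2}\int_{\mathbb{C}}|f|^2e^{-|z|^2}\,d\sigma .$$ -/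

import Mathlib

open MeasureTheory
open scoped ContDiff

noncomputable section

/-- The Wirtinger derivative `∂φ = (∂φ/∂x - i ∂φ/∂y) / 2` of a function `φ : ℂ → ℂ`,
the function being differentiated in the real sense. -/
def dz (φ : ℂ → ℂ) : ℂ → ℂ := fun z =>
  (1 / 2 : ℂ) * (fderiv ℝ φ z 1 - Complex.I * fderiv ℝ φ z Complex.I)

/-- The Wirtinger derivative `∂̄φ = (∂φ/∂x + i ∂φ/∂y) / 2` of a function `φ : ℂ → ℂ`,
the function being differentiated in the real sense. -/
def dzbar (φ : ℂ → ℂ) : ℂ → ℂ := fun z =>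
  (1 / 2 : ℂ) * (fderiv ℝ φ z 1 + Complex.I * fderiv ℝ φ z Complex.I)

/-- The measure `e^{-|z|²} dσ` on `ℂ`, where `σ` is Lebesgue measure. The space
`L²(ℂ, e^{-|z|²})` consists of the functions `f` with `MemLp f 2 weightedMeasure`; since the weight
is continuous and positive, such functions are locally square integrable for `σ`. -/
def weightedMeasure : Measure ℂ :=
  (volume : Measure ℂ).withDensity fun z => ENNReal.ofReal (Real.exp (-‖z‖ ^ 2))

/-- `u` is a weak solution of `a ∂ᵏ∂̄ᵏ u + c u = g` (for locally square integrable `u` and `g`):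
`∫ u (a ∂ᵏ∂̄ᵏ φ + c φ) dσ = ∫ g φ dσ` for all smooth compactly supported `φ : ℂ → ℂ`.
The sign `(-1)^(2k)` from the integrations by parts is `1`. -/
def IsWeakSolution (k : ℕ) (a c : ℂ) (u g : ℂ → ℂ) : Prop :=
  ∀ φ : ℂ → ℂ, ContDiff ℝ ∞ φ → HasCompactSupport φ →
    (∫ z, u z * (a * (dz^[k] (dzbar^[k] φ)) z + c * φ z)) = ∫ z, g z * φ z

end

/-! The proof is by duality, in Hörmander's manner. On test functions with the dual weight
`e^{|z|²}`, the operators `∂` and `∂̄` are creation operators: their formal adjoints `-(∂̄ + z)` and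
`-(∂ + z̄)` satisfy `aA = Aa + 1`. The commutation relation alone gives `‖Aᵏw‖² ≥ ‖aᵏw‖² + k!‖w‖²`.
Applied to `∂` and then `∂̄`, it shows that `T = ∂ᵏ∂̄ᵏ` and its formal adjoint `S` satisfy `‖Tφ‖² ≥
‖Sφ‖² + (k!)²‖φ‖²`. This survives the perturbation `αT + c`, so `‖(αT + c)φ‖ ≥ |α| k! ‖φ‖`
(`norm_sq_smul_pow_pow_add_smul_ge`).

Hahn–Banach and Riesz turn this a priori estimate into a weak solution with a bound
(`exists_inner_eq_of_norm_le`). Multiplication by `e^{±|z|²/2}` moves everything into unweighted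
`L²(ℂ)`. -/

/-! ### Abstract estimates from the commutation relation. -/

/-- A pair of operators `A`, `a` that satisfies the canonical commutation relation `aA = Aa + 1`
and is formally adjoint for the semi-inner product pulled back along `J`. -/
structure IsLadderPair {V E : Type*} [AddCommGroup V] [Module ℂ V] [NormedAddCommGroup E]
    [InnerProductSpace ℂ E] (J : V →ₗ[ℂ] E) (A a : Module.End ℂ V) : Prop where
  adjoint : ∀ u v, inner ℂ (J (A u)) (J v) = inner ℂ (J u) (J (a v))
  comm : ∀ v, a (A v) = A (a v) + v

namespace IsLadderPair

variable {V E : Type*} [AddCommGroup V] [Module ℂ V] [NormedAddCommGroup E]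
  [InnerProductSpace ℂ E] {J : V →ₗ[ℂ] E} {A a B b : Module.End ℂ V}

theorem adjoint' (h : IsLadderPair J A a) (u v : V) :
    inner ℂ (J u) (J (A v)) = inner ℂ (J (a u)) (J v) := by
  rw [← inner_conj_symm, h.adjoint, inner_conj_symm]

theorem adjoint_pow (h : IsLadderPair J A a) (k : ℕ) (u v : V) :
    inner ℂ (J ((A ^ k) u)) (J v) = inner ℂ (J u) (J ((a ^ k) v)) := by
  induction k generalizing v with
  | zero => simp
  | succ k ih => rw [pow_succ', pow_succ, Module.End.mul_apply, Module.End.mul_apply, h.adjoint, ih]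

theorem comm_pow (h : IsLadderPair J A a) (k : ℕ) (v : V) :
    a ((A ^ (k + 1)) v) = (A ^ (k + 1)) (a v) + ((k : ℂ) + 1) • (A ^ k) v := by
  induction k with
  | zero => simpa using h.comm v
  | succ k ih =>
    rw [pow_succ' A (k + 1), Module.End.mul_apply, h.comm, ih, Module.End.mul_apply, map_add,
      map_smul, ← Module.End.mul_apply A (A ^ k), ← pow_succ']
    push_cast
    module

/-- This is the positivity of the cross term in `norm_sq_pow_succ_ge`. Moving `a` past `Aᵏ⁺¹` leaves
the square on the left plus `k + 1` times the same inner product for `k`, which is nonnegative by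
induction. -/
theorem norm_sq_le_re_inner (h : IsLadderPair J A a) (k : ℕ) (w : V) :
    ‖J ((A ^ k) (a w))‖ ^ 2 ≤ (inner ℂ (J (a ((A ^ k) w))) (J ((A ^ k) (a w)))).re := by
  induction k with
  | zero => simp [inner_self_eq_norm_sq_to_K, ← Complex.ofReal_pow]
  | succ k ih =>
    have e : inner ℂ (J ((A ^ k) w)) (J ((A ^ (k + 1)) (a w))) =
        inner ℂ (J (a ((A ^ k) w))) (J ((A ^ k) (a w))) := by
      rw [pow_succ', Module.End.mul_apply, h.adjoint']
    rw [h.comm_pow, map_add, map_smul, inner_add_left, inner_smul_left, e,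
      inner_self_eq_norm_sq_to_K]
    have hk : (starRingEnd ℂ) ((k : ℂ) + 1) = ((k + 1 : ℝ) : ℂ) := by simp
    rw [hk, Complex.add_re, Complex.re_ofReal_mul]
    have : 0 ≤ ((k : ℝ) + 1) * (inner ℂ (J (a ((A ^ k) w))) (J ((A ^ k) (a w)))).re :=
      mul_nonneg (by positivity) ((sq_nonneg _).trans ih)
    simpa [← Complex.ofReal_pow] using this

/-- Write the right side as `⟨Aᵏw, aAᵏ⁺¹w⟩` and commute `a` to the right: the commutator gives the
first term, and the remainder is `⟨aAᵏw, Aᵏaw⟩`. -/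
theorem norm_sq_pow_succ_ge (h : IsLadderPair J A a) (k : ℕ) (w : V) :
    ((k : ℝ) + 1) * ‖J ((A ^ k) w)‖ ^ 2 + ‖J ((A ^ k) (a w))‖ ^ 2 ≤
      ‖J ((A ^ (k + 1)) w)‖ ^ 2 := by
  have e : (inner ℂ (J ((A ^ (k + 1)) w)) (J ((A ^ (k + 1)) w))) =
      inner ℂ (J (a ((A ^ k) w))) (J ((A ^ k) (a w))) +
        (((k + 1 : ℝ) * ‖J ((A ^ k) w)‖ ^ 2 : ℝ) : ℂ) := by
    have e1 : inner ℂ (J ((A ^ (k + 1)) w)) (J ((A ^ (k + 1)) w)) =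
        inner ℂ (J ((A ^ k) w)) (J (a ((A ^ (k + 1)) w))) := by
      rw [← h.adjoint, pow_succ', Module.End.mul_apply]
    rw [e1, h.comm_pow, map_add, map_smul, inner_add_right, inner_smul_right,
      inner_self_eq_norm_sq_to_K, pow_succ', Module.End.mul_apply, h.adjoint']
    simp
  have e' := congrArg Complex.re e
  rw [inner_self_eq_norm_sq_to_K, Complex.add_re, Complex.ofReal_re] at e'
  have := h.norm_sq_le_re_inner k w
  have e2 : ((RCLike.ofReal ‖J ((A ^ (k + 1)) w)‖ : ℂ) ^ 2).re = ‖J ((A ^ (k + 1)) w)‖ ^ 2 := by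
    simp [← Complex.ofReal_pow]
  rw [e2] at e'
  linarith

theorem factorial_mul_norm_sq_le (h : IsLadderPair J A a) (k : ℕ) (w : V) :
    (k.factorial : ℝ) * ‖J w‖ ^ 2 ≤ ‖J ((A ^ k) w)‖ ^ 2 := by
  induction k with
  | zero => simp
  | succ k ih =>
    have h1 := h.norm_sq_pow_succ_ge k w
    have h2 := mul_le_mul_of_nonneg_left ih (by positivity : (0 : ℝ) ≤ (k : ℝ) + 1)
    have h3 := sq_nonneg ‖J ((A ^ k) (a w))‖
    rw [Nat.factorial_succ]
    push_cast
    linarith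

theorem norm_sq_pow_le (h : IsLadderPair J A a) (k : ℕ) (w : V) :
    ‖J ((a ^ k) w)‖ ^ 2 ≤ ‖J ((A ^ k) w)‖ ^ 2 := by
  induction k generalizing w with
  | zero => simp
  | succ k ih =>
    have h1 := h.norm_sq_pow_succ_ge k w
    have h2 := ih (a w)
    have h3 : 0 ≤ ((k : ℝ) + 1) * ‖J ((A ^ k) w)‖ ^ 2 := by positivity
    rw [pow_succ a, Module.End.mul_apply]
    linarith

/-- One application of `norm_sq_pow_succ_ge` splits off both terms, each then bounded by its own
induction. At `k = 0` the claim fails unless `J w = 0`. -/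
theorem norm_sq_pow_add_le (h : IsLadderPair J A a) {k : ℕ} (hk : 1 ≤ k) (w : V) :
    ‖J ((a ^ k) w)‖ ^ 2 + (k.factorial : ℝ) * ‖J w‖ ^ 2 ≤ ‖J ((A ^ k) w)‖ ^ 2 := by
  obtain ⟨k, rfl⟩ := Nat.exists_eq_add_of_le' hk
  have h1 := h.norm_sq_pow_succ_ge k w
  have h2 := mul_le_mul_of_nonneg_left (h.factorial_mul_norm_sq_le k w)
    (by positivity : (0 : ℝ) ≤ (k : ℝ) + 1)
  have h3 := h.norm_sq_pow_le k (a w)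
  rw [pow_succ a, Module.End.mul_apply, Nat.factorial_succ]
  push_cast
  linarith

theorem norm_sq_pow_pow_add_le (hA : IsLadderPair J A a) (hB : IsLadderPair J B b)
    (hc : Commute a B) {k : ℕ} (hk : 1 ≤ k) (v : V) :
    ‖J ((b ^ k) ((a ^ k) v))‖ ^ 2 + (k.factorial : ℝ) ^ 2 * ‖J v‖ ^ 2 ≤
      ‖J ((A ^ k) ((B ^ k) v))‖ ^ 2 := by
  have h1 := hA.norm_sq_pow_add_le hk ((B ^ k) v)
  have h2 := mul_le_mul_of_nonneg_left (hB.factorial_mul_norm_sq_le k v)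
    (by positivity : (0 : ℝ) ≤ (k.factorial : ℝ))
  have h3 := hB.norm_sq_pow_le k ((a ^ k) v)
  -- Commuting `aᵏ` past `Bᵏ` puts `Bᵏ` outermost, where the estimate for `B` turns it into `bᵏ`.
  rw [← Module.End.mul_apply, (hc.pow_pow k k).eq, Module.End.mul_apply] at h1
  linarith [sq (k.factorial : ℝ)]

/-- The scalar `c` drops out because adding it to an operator does not change the commutator of
the operator with its adjoint. -/
theorem norm_sq_smul_pow_pow_add_smul_ge (hA : IsLadderPair J A a) (hB : IsLadderPair J B b)
    (hc : Commute a B) {k : ℕ} (hk : 1 ≤ k) (α : ℝ) (c : ℂ) (v : V) :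
    (|α| * k.factorial) ^ 2 * ‖J v‖ ^ 2 ≤
      ‖J ((α : ℂ) • (A ^ k) ((B ^ k) v) + c • v)‖ ^ 2 := by
  set T := (A ^ k) ((B ^ k) v) with hT
  set S := (b ^ k) ((a ^ k) v) with hS
  have hTS : inner ℂ (J T) (J v) = inner ℂ (J v) (J S) := by
    rw [hT, hA.adjoint_pow, hB.adjoint_pow]
  have key : ‖J T‖ ^ 2 ≥ ‖J S‖ ^ 2 + (k.factorial : ℝ) ^ 2 * ‖J v‖ ^ 2 :=
    hA.norm_sq_pow_pow_add_le hB hc hk v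
  -- The cross terms on the two sides are complex conjugates, so their real parts cancel.
  have e : ‖J ((α : ℂ) • T + c • v)‖ ^ 2 - α ^ 2 * ‖J T‖ ^ 2 =
      ‖J ((α : ℂ) • S + (starRingEnd ℂ c) • v)‖ ^ 2 - α ^ 2 * ‖J S‖ ^ 2 := by
    simp only [map_add, map_smul]
    rw [@norm_add_sq ℂ, @norm_add_sq ℂ]
    have e1 : inner ℂ ((α : ℂ) • J S) ((starRingEnd ℂ c) • J v) =
        starRingEnd ℂ (inner ℂ ((α : ℂ) • J T) (c • J v)) := by
      rw [inner_smul_left, inner_smul_left, inner_smul_right, inner_smul_right, hTS,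
        ← inner_conj_symm (J S) (J v)]
      simp
    rw [e1, RCLike.conj_re]
    simp only [norm_smul, mul_pow, RCLike.norm_conj, Complex.norm_real, Real.norm_eq_abs, sq_abs]
    ring
  have h1 := sq_nonneg ‖J ((α : ℂ) • S + (starRingEnd ℂ c) • v)‖
  have h2 := mul_le_mul_of_nonneg_left key (sq_nonneg α)
  rw [mul_pow, sq_abs]
  linarith

end IsLadderPair

/-! ### Duality. -/

/-- An a priori estimate for `L` gives a solution of the adjoint equation, with a bound. -/
theorem exists_inner_eq_of_norm_le {V E : Type*} [AddCommGroup V] [Module ℂ V]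
    [NormedAddCommGroup E] [InnerProductSpace ℂ E] [CompleteSpace E] (J L : V →ₗ[ℂ] E) {C : ℝ}
    (hC : 0 ≤ C) (h : ∀ v, ‖J v‖ ≤ C * ‖L v‖) (g : E) :
    ∃ w : E, ‖w‖ ≤ C * ‖g‖ ∧ ∀ v, inner ℂ w (L v) = inner ℂ g (J v) := by
  -- The estimate makes `L v ↦ ⟨g, J v⟩` well defined on the range of `L`, with norm at most `C‖g‖`.
  have hker : LinearMap.ker L ≤ LinearMap.ker ((innerSL ℂ g).toLinearMap ∘ₗ J) := by
    intro v hv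
    have h0 : J v = 0 := by
      have := h v
      rw [LinearMap.mem_ker.1 hv, norm_zero, mul_zero] at this
      exact norm_le_zero_iff.1 this
    simp [h0]
  let ℓ : LinearMap.range L →ₗ[ℂ] ℂ :=
    (LinearMap.ker L).liftQ _ hker ∘ₗ L.quotKerEquivRange.symm.toLinearMap
  have hℓ : ∀ v, ℓ ⟨L v, LinearMap.mem_range_self L v⟩ = inner ℂ g (J v) := by
    intro v
    simp [ℓ, LinearMap.quotKerEquivRange_symm_apply_image]
  have hb : ∀ x, ‖ℓ x‖ ≤ (C * ‖g‖) * ‖x‖ := by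
    rintro ⟨_, v, rfl⟩
    rw [hℓ]
    calc ‖inner ℂ g (J v)‖ ≤ ‖g‖ * ‖J v‖ := norm_inner_le_norm _ _
      _ ≤ ‖g‖ * (C * ‖L v‖) := by gcongr; exact h v
      _ = (C * ‖g‖) * ‖L v‖ := by ring
  obtain ⟨F, hF, hFn⟩ := exists_extension_norm_eq _ (ℓ.mkContinuous _ hb)
  refine ⟨(InnerProductSpace.toDual ℂ E).symm F, ?_, fun v => ?_⟩
  · rw [LinearIsometryEquiv.norm_map, hFn]
    exact ℓ.mkContinuous_norm_le (by positivity) hb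
  · rw [InnerProductSpace.toDual_symm_apply, ← hℓ]
    exact hF ⟨L v, LinearMap.mem_range_self L v⟩

/-! ### Removing the weight, and calculus of the Wirtinger derivatives. -/

theorem memLp_weightedMeasure_iff {f : ℂ → ℂ} :
    MemLp f 2 weightedMeasure ↔
      MemLp (fun z => f z * (Real.exp (-‖z‖ ^ 2 / 2) : ℂ)) 2 volume := by
  have hm : Measurable fun z : ℂ => ENNReal.ofReal (Real.exp (-‖z‖ ^ 2)) := by fun_prop
  have hc : Continuous fun z : ℂ => (Real.exp (-‖z‖ ^ 2 / 2) : ℂ) := by fun_prop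
  have hc' : Continuous fun z : ℂ => (Real.exp (‖z‖ ^ 2 / 2) : ℂ) := by fun_prop
  have h1 : (volume : Measure ℂ) ≪ weightedMeasure :=
    withDensity_absolutelyContinuous' hm.aemeasurable
      (.of_forall fun z => (ENNReal.ofReal_pos.2 (Real.exp_pos _)).ne')
  have h2 : weightedMeasure ≪ (volume : Measure ℂ) := withDensity_absolutelyContinuous _ _
  have key (hf : AEStronglyMeasurable f volume) : MemLp f 2 weightedMeasure ↔
      MemLp (fun z => f z * (Real.exp (-‖z‖ ^ 2 / 2) : ℂ)) 2 volume := by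
    rw [memLp_two_iff_integrable_sq_norm (hf.mono_ac h2),
      memLp_two_iff_integrable_sq_norm
        (f := fun z => f z * (Real.exp (-‖z‖ ^ 2 / 2) : ℂ)) (hf.mul hc.aestronglyMeasurable),
      weightedMeasure,
      integrable_withDensity_iff_integrable_smul' hm (by simp)]
    refine integrable_congr (.of_forall fun z => ?_)
    simp only [ENNReal.toReal_ofReal (Real.exp_pos _).le, smul_eq_mul, norm_mul, mul_pow,
      Complex.norm_real, Real.norm_eq_abs, sq_abs, ← Real.exp_nat_mul]
    rw [mul_comm]
    congr 2
    push_cast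
    ring
  constructor
  · exact fun h => (key (h.1.mono_ac h1)).1 h
  · refine fun h => (key ?_).2 h
    refine (h.1.mul hc'.aestronglyMeasurable).congr (.of_forall fun z => ?_)
    simp only [Pi.mul_apply]
    rw [mul_assoc, ← Complex.ofReal_mul, ← Real.exp_add]
    ring_nf
    simp

theorem dz_mul {f g : ℂ → ℂ} {z : ℂ} (hf : DifferentiableAt ℝ f z) (hg : DifferentiableAt ℝ g z) :
    dz (fun w => f w * g w) z = dz f z * g z + f z * dz g z := by
  simp only [dz, fderiv_fun_mul hf hg, add_apply, smul_apply,
    smul_eq_mul]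
  ring

theorem dzbar_mul {f g : ℂ → ℂ} {z : ℂ} (hf : DifferentiableAt ℝ f z)
    (hg : DifferentiableAt ℝ g z) :
    dzbar (fun w => f w * g w) z = dzbar f z * g z + f z * dzbar g z := by
  simp only [dzbar, fderiv_fun_mul hf hg, add_apply,
    smul_apply, smul_eq_mul]
  ring

theorem dz_conj {f : ℂ → ℂ} {z : ℂ} (hf : DifferentiableAt ℝ f z) :
    dz (fun w => starRingEnd ℂ (f w)) z = starRingEnd ℂ (dzbar f z) := by
  have : fderiv ℝ (fun w => starRingEnd ℂ (f w)) z =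
      (Complex.conjCLE : ℂ →L[ℝ] ℂ).comp (fderiv ℝ f z) :=
    ((Complex.conjCLE : ℂ →L[ℝ] ℂ).hasFDerivAt.comp z hf.hasFDerivAt).fderiv
  simp only [dz, dzbar, this, ContinuousLinearMap.comp_apply, map_mul, map_add, map_div₀,
    map_one, Complex.conj_I, map_ofNat, ContinuousLinearEquiv.coe_coe, Complex.conjCLE_apply]
  ring

theorem dzbar_conj {f : ℂ → ℂ} {z : ℂ} (hf : DifferentiableAt ℝ f z) :
    dzbar (fun w => starRingEnd ℂ (f w)) z = starRingEnd ℂ (dz f z) := by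
  have : fderiv ℝ (fun w => starRingEnd ℂ (f w)) z =
      (Complex.conjCLE : ℂ →L[ℝ] ℂ).comp (fderiv ℝ f z) :=
    ((Complex.conjCLE : ℂ →L[ℝ] ℂ).hasFDerivAt.comp z hf.hasFDerivAt).fderiv
  simp only [dz, dzbar, this, ContinuousLinearMap.comp_apply, map_mul, map_sub, map_div₀,
    map_one, Complex.conj_I, map_ofNat, ContinuousLinearEquiv.coe_coe, Complex.conjCLE_apply]
  ring

theorem fderiv_exp_norm_sq (z v : ℂ) :
    fderiv ℝ (fun w : ℂ => (Real.exp (‖w‖ ^ 2) : ℂ)) z v =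
      ((Real.exp (‖z‖ ^ 2) * (2 * (z.re * v.re + z.im * v.im)) : ℝ) : ℂ) := by
  have h := (Complex.ofRealCLM.hasFDerivAt.comp z
    (hasStrictFDerivAt_norm_sq z).hasFDerivAt.exp).fderiv
  have h' : fderiv ℝ (fun w : ℂ => (Real.exp (‖w‖ ^ 2) : ℂ)) z = _ := h
  rw [h']
  simp [Complex.inner]
  ring

theorem dz_exp_norm_sq (z : ℂ) :
    dz (fun w : ℂ => (Real.exp (‖w‖ ^ 2) : ℂ)) z =
      starRingEnd ℂ z * (Real.exp (‖z‖ ^ 2) : ℂ) := by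
  simp only [dz, fderiv_exp_norm_sq]
  apply Complex.ext <;> simp [-Complex.ofReal_exp] <;> ring

theorem dzbar_exp_norm_sq (z : ℂ) :
    dzbar (fun w : ℂ => (Real.exp (‖w‖ ^ 2) : ℂ)) z = z * (Real.exp (‖z‖ ^ 2) : ℂ) := by
  simp only [dzbar, fderiv_exp_norm_sq]
  apply Complex.ext <;> simp [-Complex.ofReal_exp] <;> ring

theorem dz_id (z : ℂ) : dz (fun w => w) z = 1 := by
  simp [dz]
  norm_num

theorem dzbar_conj_id (z : ℂ) : dzbar (fun w => starRingEnd ℂ w) z = 1 := by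
  rw [dzbar_conj differentiableAt_fun_id, dz_id, map_one]

theorem contDiff_dz {f : ℂ → ℂ} (hf : ContDiff ℝ ∞ f) : ContDiff ℝ ∞ (dz f) := by
  have h (v : ℂ) : ContDiff ℝ ∞ fun z => fderiv ℝ f z v :=
    (hf.fderiv_right (m := ∞) (by simp)).clm_apply contDiff_const
  exact contDiff_const.mul ((h 1).sub (contDiff_const.mul (h Complex.I)))

theorem contDiff_dzbar {f : ℂ → ℂ} (hf : ContDiff ℝ ∞ f) : ContDiff ℝ ∞ (dzbar f) := by
  have h (v : ℂ) : ContDiff ℝ ∞ fun z => fderiv ℝ f z v :=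
    (hf.fderiv_right (m := ∞) (by simp)).clm_apply contDiff_const
  exact contDiff_const.mul ((h 1).add (contDiff_const.mul (h Complex.I)))

theorem hasCompactSupport_dz {f : ℂ → ℂ} (hf : HasCompactSupport f) :
    HasCompactSupport (dz f) :=
  (((hf.fderiv_apply ℝ 1)).sub ((hf.fderiv_apply ℝ Complex.I).mul_left
    (f := fun _ => Complex.I))).mul_left (f := fun _ => (1 / 2 : ℂ))

theorem hasCompactSupport_dzbar {f : ℂ → ℂ} (hf : HasCompactSupport f) :
    HasCompactSupport (dzbar f) :=
  (((hf.fderiv_apply ℝ 1)).add ((hf.fderiv_apply ℝ Complex.I).mul_left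
    (f := fun _ => Complex.I))).mul_left (f := fun _ => (1 / 2 : ℂ))

theorem dz_dzbar_comm {f : ℂ → ℂ} (hf : ContDiff ℝ ∞ f) : dz (dzbar f) = dzbar (dz f) := by
  funext z
  have hd : DifferentiableAt ℝ (fderiv ℝ f) z :=
    ((hf.fderiv_right (m := ∞) (by simp)).differentiable (by simp)) z
  have h (v : ℂ) : DifferentiableAt ℝ (fun w => fderiv ℝ f w v) z :=
    hd.clm_apply (differentiableAt_const v)
  have h' (v w : ℂ) : fderiv ℝ (fun y => fderiv ℝ f y v) z w = fderiv ℝ (fderiv ℝ f) z w v := by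
    rw [fderiv_clm_apply hd (differentiableAt_const v)]
    simp
  have hs := ((contDiff_infty.1 hf 2).contDiffAt (x := z)).isSymmSndFDerivAt
    (by simp) 1 Complex.I
  have e1 (w : ℂ) : fderiv ℝ (dzbar f) z w = (1 / 2 : ℂ) *
      (fderiv ℝ (fderiv ℝ f) z w 1 + Complex.I * fderiv ℝ (fderiv ℝ f) z w Complex.I) := by
    have : fderiv ℝ (dzbar f) z = _ :=
      ((((h 1).hasFDerivAt.add ((h Complex.I).hasFDerivAt.const_mul Complex.I)).const_mul
        (1 / 2 : ℂ))).fderiv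
    simp only [this, add_apply, smul_apply, smul_eq_mul, h']
  have e2 (w : ℂ) : fderiv ℝ (dz f) z w = (1 / 2 : ℂ) *
      (fderiv ℝ (fderiv ℝ f) z w 1 - Complex.I * fderiv ℝ (fderiv ℝ f) z w Complex.I) := by
    have : fderiv ℝ (dz f) z = _ :=
      ((((h 1).hasFDerivAt.sub ((h Complex.I).hasFDerivAt.const_mul Complex.I)).const_mul
        (1 / 2 : ℂ))).fderiv
    simp only [this, sub_apply, smul_apply, smul_eq_mul, h']
  rw [dz, dzbar, e1, e1, e2, e2, hs]
  ring

theorem integral_fderiv_apply_eq_zero {f : ℂ → ℂ} (hf : ContDiff ℝ ∞ f)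
    (hs : HasCompactSupport f) (v : ℂ) : ∫ z, fderiv ℝ f z v = 0 := by
  have hc : Continuous fun z => fderiv ℝ f z v :=
    (hf.continuous_fderiv (by simp)).clm_apply continuous_const
  -- Integration by parts against the constant `1`; only the products have to be integrable.
  have := integral_mul_fderiv_eq_neg_fderiv_mul_of_integrable (μ := (volume : Measure ℂ))
    (f := fun _ : ℂ => (1 : ℂ)) (g := f) (v := v) (by simp)
    (by simpa using hc.integrable_of_hasCompactSupport (hs.fderiv_apply ℝ v))
    (by simpa using hf.continuous.integrable_of_hasCompactSupport hs)
    (by simp) (fun z _ => hf.differentiable (by simp) z)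
  simpa using this

theorem integral_dz_eq_zero {f : ℂ → ℂ} (hf : ContDiff ℝ ∞ f) (hs : HasCompactSupport f) :
    ∫ z, dz f z = 0 := by
  have hi (v : ℂ) : Integrable fun z => fderiv ℝ f z v :=
    ((hf.continuous_fderiv (by simp)).clm_apply continuous_const).integrable_of_hasCompactSupport
      (hs.fderiv_apply ℝ v)
  simp only [dz]
  rw [integral_const_mul, integral_sub (hi 1) ((hi Complex.I).const_mul _), integral_const_mul,
    integral_fderiv_apply_eq_zero hf hs, integral_fderiv_apply_eq_zero hf hs]
  simp

theorem integral_dzbar_eq_zero {f : ℂ → ℂ} (hf : ContDiff ℝ ∞ f) (hs : HasCompactSupport f) :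
    ∫ z, dzbar f z = 0 := by
  have hi (v : ℂ) : Integrable fun z => fderiv ℝ f z v :=
    ((hf.continuous_fderiv (by simp)).clm_apply continuous_const).integrable_of_hasCompactSupport
      (hs.fderiv_apply ℝ v)
  simp only [dzbar]
  rw [integral_const_mul, integral_add (hi 1) ((hi Complex.I).const_mul _), integral_const_mul,
    integral_fderiv_apply_eq_zero hf hs, integral_fderiv_apply_eq_zero hf hs]
  simp

/-! ### Test functions as a ladder representation. -/

noncomputable section

/-- The space of smooth compactly supported functions `ℂ → ℂ`. -/
def smoothCompactlySupported : Submodule ℂ (ℂ → ℂ) where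
  carrier := {φ | ContDiff ℝ ∞ φ ∧ HasCompactSupport φ}
  add_mem' h h' := ⟨h.1.add h'.1, h.2.add h'.2⟩
  zero_mem' := ⟨contDiff_const, HasCompactSupport.zero⟩
  smul_mem' c _ h := ⟨contDiff_const.smul h.1, h.2.smul_left (f := fun _ => c)⟩

namespace smoothCompactlySupported

theorem contDiff_coe (φ : smoothCompactlySupported) : ContDiff ℝ ∞ (φ : ℂ → ℂ) := φ.2.1

theorem hasCompactSupport_coe (φ : smoothCompactlySupported) : HasCompactSupport (φ : ℂ → ℂ) := φ.2.2

theorem differentiable_coe (φ : smoothCompactlySupported) : Differentiable ℝ (φ : ℂ → ℂ) :=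
  (contDiff_coe φ).differentiable (by simp)

/-- `∂` as an operator on smooth compactly supported functions. -/
def del : Module.End ℂ smoothCompactlySupported where
  toFun φ := ⟨dz φ, contDiff_dz (contDiff_coe φ), hasCompactSupport_dz (hasCompactSupport_coe φ)⟩
  map_add' φ ψ := by
    ext z
    simp only [dz, Submodule.coe_add, Pi.add_apply,
      fderiv_add ((differentiable_coe φ) z) ((differentiable_coe ψ) z), add_apply]
    ring
  map_smul' c φ := by
    ext z
    simp only [dz, Submodule.coe_smul, Pi.smul_apply, RingHom.id_apply,
      fderiv_const_smul ((differentiable_coe φ) z) c, smul_apply, smul_eq_mul]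
    ring

/-- `∂̄` as an operator on smooth compactly supported functions. -/
def delbar : Module.End ℂ smoothCompactlySupported where
  toFun φ := ⟨dzbar φ, contDiff_dzbar (contDiff_coe φ), hasCompactSupport_dzbar (hasCompactSupport_coe φ)⟩
  map_add' φ ψ := by
    ext z
    simp only [dzbar, Submodule.coe_add, Pi.add_apply,
      fderiv_add ((differentiable_coe φ) z) ((differentiable_coe ψ) z), add_apply]
    ring
  map_smul' c φ := by
    ext z
    simp only [dzbar, Submodule.coe_smul, Pi.smul_apply, RingHom.id_apply,
      fderiv_const_smul ((differentiable_coe φ) z) c, smul_apply, smul_eq_mul]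
    ring

/-- Multiplication by a smooth function. -/
def mulBy (g : ℂ → ℂ) (hg : ContDiff ℝ ∞ g) : Module.End ℂ smoothCompactlySupported where
  toFun φ := ⟨fun z => g z * φ.1 z, hg.mul (contDiff_coe φ), (hasCompactSupport_coe φ).mul_left⟩
  map_add' φ ψ := by
    ext z
    simp [mul_add]
  map_smul' c φ := by
    ext z
    simp [mul_left_comm]

theorem contDiff_conj : ContDiff ℝ ∞ fun z : ℂ => starRingEnd ℂ z :=
  (Complex.conjCLE : ℂ →L[ℝ] ℂ).contDiff

/-- The formal adjoint of `∂` for the weight `e^{|z|²}`. -/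
def delAdj : Module.End ℂ smoothCompactlySupported := -(delbar + mulBy (fun z => z) contDiff_id)

/-- The formal adjoint of `∂̄` for the weight `e^{|z|²}`. -/
def delbarAdj : Module.End ℂ smoothCompactlySupported :=
  -(del + mulBy (fun z => starRingEnd ℂ z) contDiff_conj)

theorem memLp_mul_exp (φ : smoothCompactlySupported) :
    MemLp (fun z => φ.1 z * (Real.exp (‖z‖ ^ 2 / 2) : ℂ)) 2 volume :=
  ((contDiff_coe φ).continuous.mul (by fun_prop)).memLp_of_hasCompactSupport
    (hasCompactSupport_coe φ).mul_right

/-- The embedding `φ ↦ φ e^{|z|²/2}` into `L²(ℂ)`, so that the inner product of `L²(ℂ)` pulls back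
to the one with weight `e^{|z|²}`. -/
def toL2 : smoothCompactlySupported →ₗ[ℂ] Lp ℂ 2 (volume : Measure ℂ) where
  toFun φ := (memLp_mul_exp φ).toLp _
  map_add' φ ψ := by
    rw [← MemLp.toLp_add]
    congr 1
    ext z
    simp [add_mul]
  map_smul' c φ := by
    rw [RingHom.id_apply, ← MemLp.toLp_const_smul]
    congr 1
    ext z
    simp [mul_assoc]

theorem inner_toL2 (φ ψ : smoothCompactlySupported) :
    inner ℂ (toL2 φ) (toL2 ψ) =
      ∫ z, ψ.1 z * starRingEnd ℂ (φ.1 z) * (Real.exp (‖z‖ ^ 2) : ℂ) := by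
  rw [L2.inner_def]
  refine integral_congr_ae ?_
  filter_upwards [(memLp_mul_exp φ).coeFn_toLp, (memLp_mul_exp ψ).coeFn_toLp] with z h1 h2
  have h3 : (Real.exp (‖z‖ ^ 2) : ℂ) =
      (Real.exp (‖z‖ ^ 2 / 2) : ℂ) * (Real.exp (‖z‖ ^ 2 / 2) : ℂ) := by
    rw [← Complex.ofReal_mul, ← Real.exp_add, add_halves]
  change inner ℂ (((memLp_mul_exp φ).toLp _ : Lp ℂ 2 volume) z)
    (((memLp_mul_exp ψ).toLp _ : Lp ℂ 2 volume) z) = _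
  rw [h1, h2, h3, RCLike.inner_apply, map_mul, Complex.conj_ofReal]
  ring

theorem integrable_mul_conj_mul_exp (φ ψ : smoothCompactlySupported) :
    Integrable fun z => ψ.1 z * starRingEnd ℂ (φ.1 z) * (Real.exp (‖z‖ ^ 2) : ℂ) :=
  (((contDiff_coe ψ).continuous.mul (Complex.continuous_conj.comp (contDiff_coe φ).continuous)).mul
    (by fun_prop)).integrable_of_hasCompactSupport (hasCompactSupport_coe ψ).mul_right.mul_right

theorem contDiff_exp_norm_sq : ContDiff ℝ ∞ fun z : ℂ => (Real.exp (‖z‖ ^ 2) : ℂ) :=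
  Complex.ofRealCLM.contDiff.comp (contDiff_norm_sq ℝ).exp

/-- The difference of the two sides is the integral of `∂̄(ψ φ̄ e^{|z|²})`, since conjugation turns
`∂φ` into `∂̄φ̄` and `∂̄e^{|z|²} = z e^{|z|²}`. -/
theorem inner_toL2_del (φ ψ : smoothCompactlySupported) :
    inner ℂ (toL2 (del φ)) (toL2 ψ) = inner ℂ (toL2 φ) (toL2 (delAdj ψ)) := by
  have hφ : ContDiff ℝ ∞ fun z => starRingEnd ℂ (φ.1 z) := contDiff_conj.comp (contDiff_coe φ)
  have h0 := integral_dzbar_eq_zero (((contDiff_coe ψ).mul hφ).mul contDiff_exp_norm_sq)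
    (hasCompactSupport_coe ψ).mul_right.mul_right
  rw [inner_toL2, inner_toL2, ← sub_eq_zero, ← integral_sub
    (integrable_mul_conj_mul_exp _ _) (integrable_mul_conj_mul_exp _ _), ← h0]
  refine integral_congr_ae (.of_forall fun z => ?_)
  have hψz := (differentiable_coe ψ) z
  have hφz : DifferentiableAt ℝ (fun z => starRingEnd ℂ (φ.1 z)) z :=
    hφ.differentiable (by simp) z
  beta_reduce
  rw [dzbar_mul (f := fun z => ψ.1 z * starRingEnd ℂ (φ.1 z)) (hψz.mul hφz)
      (contDiff_exp_norm_sq.differentiable (by simp) z),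
    dzbar_mul hψz hφz, dzbar_conj ((differentiable_coe φ) z), dzbar_exp_norm_sq]
  simp only [delAdj, del, delbar, mulBy, LinearMap.neg_apply, LinearMap.add_apply, LinearMap.coe_mk,
    AddHom.coe_mk, Submodule.coe_neg, Submodule.coe_add, Pi.neg_apply, Pi.add_apply]
  ring

theorem inner_toL2_delbar (φ ψ : smoothCompactlySupported) :
    inner ℂ (toL2 (delbar φ)) (toL2 ψ) = inner ℂ (toL2 φ) (toL2 (delbarAdj ψ)) := by
  have hφ : ContDiff ℝ ∞ fun z => starRingEnd ℂ (φ.1 z) := contDiff_conj.comp (contDiff_coe φ)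
  have h0 := integral_dz_eq_zero (((contDiff_coe ψ).mul hφ).mul contDiff_exp_norm_sq)
    (hasCompactSupport_coe ψ).mul_right.mul_right
  rw [inner_toL2, inner_toL2, ← sub_eq_zero, ← integral_sub
    (integrable_mul_conj_mul_exp _ _) (integrable_mul_conj_mul_exp _ _), ← h0]
  refine integral_congr_ae (.of_forall fun z => ?_)
  have hψz := (differentiable_coe ψ) z
  have hφz : DifferentiableAt ℝ (fun z => starRingEnd ℂ (φ.1 z)) z :=
    hφ.differentiable (by simp) z
  beta_reduce
  rw [dz_mul (f := fun z => ψ.1 z * starRingEnd ℂ (φ.1 z)) (hψz.mul hφz)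
      (contDiff_exp_norm_sq.differentiable (by simp) z),
    dz_mul hψz hφz, dz_conj ((differentiable_coe φ) z), dz_exp_norm_sq]
  simp only [delbarAdj, del, delbar, mulBy, LinearMap.neg_apply, LinearMap.add_apply,
    LinearMap.coe_mk, AddHom.coe_mk, Submodule.coe_neg, Submodule.coe_add, Pi.neg_apply,
    Pi.add_apply]
  ring

theorem del_delbar_comm (φ : smoothCompactlySupported) : del (delbar φ) = delbar (del φ) :=
  Subtype.ext (dz_dzbar_comm (contDiff_coe φ))

theorem del_mulBy (g : ℂ → ℂ) (hg : ContDiff ℝ ∞ g) (φ : smoothCompactlySupported) :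
    del (mulBy g hg φ) = mulBy (dz g) (contDiff_dz hg) φ + mulBy g hg (del φ) :=
  Subtype.ext (funext fun z => dz_mul (hg.differentiable (by simp) z) ((differentiable_coe φ) z))

theorem delbar_mulBy (g : ℂ → ℂ) (hg : ContDiff ℝ ∞ g) (φ : smoothCompactlySupported) :
    delbar (mulBy g hg φ) = mulBy (dzbar g) (contDiff_dzbar hg) φ + mulBy g hg (delbar φ) :=
  Subtype.ext (funext fun z => dzbar_mul (hg.differentiable (by simp) z) ((differentiable_coe φ) z))

theorem isLadderPair_del : IsLadderPair toL2 del delAdj where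
  adjoint := inner_toL2_del
  comm φ := by
    -- The `+ 1` of the commutation relation is `∂z = 1`.
    have h : mulBy (dz fun z => z) (contDiff_dz contDiff_id) φ = φ :=
      Subtype.ext (funext fun z => by simp [mulBy, dz_id])
    simp only [delAdj, LinearMap.neg_apply, LinearMap.add_apply, map_neg, map_add, del_mulBy, h,
      del_delbar_comm]
    abel

theorem isLadderPair_delbar : IsLadderPair toL2 delbar delbarAdj where
  adjoint := inner_toL2_delbar
  comm φ := by
    have h : mulBy (dzbar fun z => starRingEnd ℂ z) (contDiff_dzbar contDiff_conj) φ = φ :=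
      Subtype.ext (funext fun z => by simp [mulBy, dzbar_conj_id])
    simp only [delbarAdj, LinearMap.neg_apply, LinearMap.add_apply, map_neg, map_add, delbar_mulBy,
      h, del_delbar_comm]
    abel

/-- The adjoint of `∂` involves only `∂̄` and multiplication by the holomorphic function `z`. -/
theorem commute_delAdj_delbar : Commute delAdj delbar := by
  refine LinearMap.ext fun φ => ?_
  have h : mulBy (dzbar fun z => z) (contDiff_dzbar contDiff_id) φ = 0 :=
    Subtype.ext (funext fun z => by simp [mulBy, dzbar])
  simp only [Module.End.mul_apply, delAdj, LinearMap.neg_apply, LinearMap.add_apply, map_neg,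
    map_add, delbar_mulBy, h]
  abel

theorem coe_del_pow (k : ℕ) (φ : smoothCompactlySupported) : ((del ^ k) φ : ℂ → ℂ) = dz^[k] φ := by
  induction k with
  | zero => rfl
  | succ k ih =>
    rw [pow_succ', Module.End.mul_apply, Function.iterate_succ_apply', ← ih]
    rfl

theorem coe_delbar_pow (k : ℕ) (φ : smoothCompactlySupported) :
    ((delbar ^ k) φ : ℂ → ℂ) = dzbar^[k] φ := by
  induction k with
  | zero => rfl
  | succ k ih =>
    rw [pow_succ', Module.End.mul_apply, Function.iterate_succ_apply', ← ih]
    rfl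

end smoothCompactlySupported

open smoothCompactlySupported

/-! ### Back to weighted integrals, and the conclusion. -/

theorem inner_toL2_eq_integral {F : ℂ → ℂ} {g : Lp ℂ 2 (volume : Measure ℂ)}
    (h : ∀ᵐ z, starRingEnd ℂ (g z) = F z) (φ : smoothCompactlySupported) :
    inner ℂ g (toL2 φ) = ∫ z, F z * ((Real.exp (‖z‖ ^ 2 / 2) : ℂ) * φ.1 z) := by
  rw [L2.inner_def]
  refine integral_congr_ae ?_
  filter_upwards [h, (memLp_mul_exp φ).coeFn_toLp] with z h1 h2
  change inner ℂ (g z) (((memLp_mul_exp φ).toLp _ : Lp ℂ 2 volume) z) = _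
  rw [h2, RCLike.inner_apply, h1]
  ring

theorem norm_sq_eq_integral {F : ℂ → ℂ} {g : Lp ℂ 2 (volume : Measure ℂ)}
    (h : ∀ᵐ z, starRingEnd ℂ (g z) = F z * (Real.exp (-‖z‖ ^ 2 / 2) : ℂ)) :
    ‖g‖ ^ 2 = ∫ z, ‖F z‖ ^ 2 * Real.exp (-‖z‖ ^ 2) := by
  have e : ((‖g‖ ^ 2 : ℝ) : ℂ) = ∫ z, inner ℂ (g z) (g z) := by
    rw [← L2.inner_def, inner_self_eq_norm_sq_to_K]
    simp
  rw [← Complex.ofReal_inj, e, ← integral_complex_ofReal]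
  refine integral_congr_ae ?_
  filter_upwards [h] with z h1
  have h2 : Real.exp (-‖z‖ ^ 2) = Real.exp (-‖z‖ ^ 2 / 2) ^ 2 := by
    rw [← Real.exp_nat_mul]
    congr 1
    push_cast
    ring
  rw [inner_self_eq_norm_sq_to_K, ← RCLike.norm_conj, h1, h2, norm_mul, Complex.norm_real,
    Real.norm_eq_abs, abs_of_pos (Real.exp_pos _)]
  simp [mul_pow]

theorem exp_neg_mul_exp (z : ℂ) :
    (Real.exp (-‖z‖ ^ 2 / 2) : ℂ) * (Real.exp (‖z‖ ^ 2 / 2) : ℂ) = 1 := by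
  rw [← Complex.ofReal_mul, ← Real.exp_add]
  ring_nf
  simp

theorem norm_toL2_le {k : ℕ} (hk : 1 ≤ k) {α : ℝ} (hα : 1 ≤ |α|) (c : ℂ)
    (φ : smoothCompactlySupported) :
    ‖toL2 φ‖ ≤ (k.factorial : ℝ)⁻¹ *
      ‖(toL2 ∘ₗ ((α : ℂ) • (del ^ k * delbar ^ k) + c • 1)) φ‖ := by
  have h := isLadderPair_del.norm_sq_smul_pow_pow_add_smul_ge isLadderPair_delbar
    commute_delAdj_delbar hk α c φ
  rw [← mul_pow] at h
  have h1 := le_of_sq_le_sq h (norm_nonneg _)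
  have hk0 : (0 : ℝ) < k.factorial := mod_cast k.factorial_pos
  rw [inv_mul_eq_div, le_div_iff₀ hk0]
  -- The factor `|α| ≥ 1` is given up here; the `|α|` in the final bound comes from the datum `αf`.
  calc ‖toL2 φ‖ * k.factorial = 1 * k.factorial * ‖toL2 φ‖ := by ring
    _ ≤ |α| * k.factorial * ‖toL2 φ‖ := by gcongr
    _ ≤ _ := h1

end

open smoothCompactlySupported

theorem mainTheorem4 (k : ℕ) (hk : 1 ≤ k) (α : ℝ) (hα : 1 ≤ |α|) (c : ℂ)
    (f : ℂ → ℂ) (hf : MemLp f 2 weightedMeasure) :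
    ∃ u : ℂ → ℂ, MemLp u 2 weightedMeasure ∧
      IsWeakSolution k (α : ℂ) c u (fun z => (α : ℂ) * f z) ∧
      (∫ z, ‖u z‖ ^ 2 * Real.exp (-‖z‖ ^ 2)) ≤
        |α| ^ 2 / (k.factorial : ℝ) ^ 2 * ∫ z, ‖f z‖ ^ 2 * Real.exp (-‖z‖ ^ 2) := by
  have hF := memLp_weightedMeasure_iff.1 (hf.const_mul (α : ℂ))
  -- The datum is conjugated because the inner product is conjugate-linear in its first slot; `u`
  -- below undoes this.
  set g : Lp ℂ 2 (volume : Measure ℂ) := hF.star.toLp _ with hg_def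
  have hg : ∀ᵐ z, starRingEnd ℂ (g z) = (α : ℂ) * f z * (Real.exp (-‖z‖ ^ 2 / 2) : ℂ) := by
    filter_upwards [hF.star.coeFn_toLp] with z hz
    rw [hg_def, hz]
    exact star_star _
  obtain ⟨w, hw, hwL⟩ := exists_inner_eq_of_norm_le toL2 _ (by positivity)
    (norm_toL2_le hk hα c) g
  set u : ℂ → ℂ := fun z => starRingEnd ℂ (w z) * (Real.exp (‖z‖ ^ 2 / 2) : ℂ) with hu_def
  have hu (z : ℂ) : starRingEnd ℂ (w z) = u z * (Real.exp (-‖z‖ ^ 2 / 2) : ℂ) := by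
    rw [hu_def, mul_assoc, mul_comm (Complex.ofReal _), exp_neg_mul_exp, mul_one]
  refine ⟨u, ?_, ?_, ?_⟩
  · rw [memLp_weightedMeasure_iff]
    simp_rw [← hu]
    exact (Lp.memLp w).star
  · intro φ hφ hφs
    have h := hwL ⟨φ, hφ, hφs⟩
    rw [LinearMap.comp_apply, inner_toL2_eq_integral (.of_forall hu),
      inner_toL2_eq_integral hg] at h
    calc _ = _ := integral_congr_ae (.of_forall fun z => ?_)
      _ = _ := h
      _ = _ := integral_congr_ae (.of_forall fun z => ?_)
    · have e : (((α : ℂ) • (del ^ k * delbar ^ k) + c • 1 :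
          Module.End ℂ smoothCompactlySupported) (⟨φ, hφ, hφs⟩ : smoothCompactlySupported)).1 z =
          α * (dz^[k] (dzbar^[k] φ)) z + c * φ z := by
        rw [← coe_delbar_pow k ⟨φ, hφ, hφs⟩, ← coe_del_pow]
        rfl
      change u z * _ = _
      rw [e]
      linear_combination (-(u z) * (α * (dz^[k] (dzbar^[k] φ)) z + c * φ z)) * exp_neg_mul_exp z
    · beta_reduce
      rw [mul_assoc ((α : ℂ) * f z), ← mul_assoc (Complex.ofReal (Real.exp _)), exp_neg_mul_exp,
        one_mul]
  · rw [← norm_sq_eq_integral (.of_forall hu)]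
    calc ‖w‖ ^ 2 ≤ ((k.factorial : ℝ)⁻¹ * ‖g‖) ^ 2 := by gcongr
      _ = _ := by
        rw [mul_pow, norm_sq_eq_integral hg]
        simp_rw [norm_mul, mul_pow, mul_assoc]
        rw [integral_const_mul, Complex.norm_real, Real.norm_eq_abs]
        field_simp
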